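/- A Ferrers diagram is a top- and left-justified arrangement of cells, with possibly empty rows and columns; its length is its number of rows plus its number of columns. If a Ferrers diagram $F$ has $k$ columns, its shifted diagram $\overline F$ is obtained by adding $k$ rows of sizes $1,2,\dots,k$ above $F$, in increasing order from top to bottom; the rightmost cell of each added row is called a diagonal cell. A type $B$ permutation tableau of length $n$ is a filling of the cells of $\overline F$ with $0$s and $1$s, where $F$ is a Ferrers diagram of length $n$, such that (1) each column contains at least one $1$; (2) no $0$ has both a $1$ above it in the same column and a $1$ to the left of it in the same row; (3) a $0$ in a diagonal cell has no $1$ to the left of it in the same row. Let $PT_B(n)$ be the set of these tableaux. For $T\in PT_B(n)$ let $\mathrm{row}(T)$ be the number of rows of $F$ (the added rows are not counted), $\mathrm{diag}(T)$ the number of $1$s in diagonal cells, and $\mathrm{so}(T)$ the number of $1$s that have a $1$ above them in the same column. Put $$B_n(y,t,q)=\sum_{T\in PT_B(n)} y^{2\,\mathrm{row}(T)+\mathrm{diag}(T)}\,t^{\mathrm{diag}(T)}\,q^{\mathrm{so}(T)}.$$ **Theorem.** Let $R$ be a commutative ring and $y,q\in R$ (for instance the two indeterminates of $R=\mathbb Z[y,q]$),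 and let $D_q$ be the $q$-derivative with respect to $t$, that is, the $R$-linear operator on $R[t]$ that sends $t^n$ to $[n]_q\,t^{n-1}$ for $n\ge 1$ and $1$ to $0$, where $[n]_q=1+q+\cdots+q^{n-1}$. Then, in $R[t]$, $B_0(y,t,q)=1$ and, for all $n\ge 0$, $$B_{n+1}(y,t,q)=(y+t)\,D_q\bigl[(1+yt)\,B_n(y,t,q)\bigr].$$ -/

import Mathlib

/-- A Ferrers diagram, with possibly empty rows and columns: the list of the row lengths from top to
bottom, which is weakly decreasing, and the number of columns, which bounds every row length. -/
structure FerrersDiagram where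
  rows : List ℕ
  cols : ℕ
  sorted : rows.Pairwise (· ≥ ·)
  le_cols : ∀ m ∈ rows, m ≤ cols

namespace FerrersDiagram

/-- The length: number of rows plus number of columns. -/
def length (F : FerrersDiagram) : ℕ := F.rows.length + F.cols

/-- Row lengths, from top to bottom, of the shifted diagram: with `k` columns, rows of size
`1, 2, …, k` are added above the diagram, in increasing order. -/
def shiftedRows (F : FerrersDiagram) : List ℕ := List.range' 1 F.cols ++ F.rows

/-- The cells `(i, j)` of the shifted diagram: row `i` counted from the top, column `j` counted from
the left, both from `0`. The added rows are those with `i < F.cols`; their rightmost cells, the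
diagonal cells, are the cells `(i, i)` with `i < F.cols`. -/
def shiftedCells (F : FerrersDiagram) : Finset (ℕ × ℕ) :=
  (Finset.range F.shiftedRows.length ×ˢ Finset.range F.cols).filter
    fun c => c.2 < F.shiftedRows.getD c.1 0

end FerrersDiagram

/-- A type `B` permutation tableau of length `n`: a `0,1`-filling of a shifted Ferrers diagram of
length `n`, given by the set `ones` of the cells that contain a `1`. -/
structure TypeBTableau (n : ℕ) where
  shape : FerrersDiagram
  length_eq : shape.length = n
  ones : Finset (ℕ × ℕ)
  ones_subset : ones ⊆ shape.shiftedCells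
  /-- Each column has at least one `1`. -/
  column_has_one : ∀ j < shape.cols, ∃ i, (i, j) ∈ ones
  /-- No `0` has a `1` above it in its column and a `1` to the left of it in its row. -/
  zero_condition : ∀ i j, (i, j) ∈ shape.shiftedCells → (i, j) ∉ ones →
    ¬ ((∃ i' < i, (i', j) ∈ ones) ∧ ∃ j' < j, (i, j') ∈ ones)
  /-- A `0` in a diagonal cell has no `1` to the left of it in its row. -/
  diagonal_condition : ∀ i < shape.cols, (i, i) ∉ ones → ¬ ∃ j' < i, (i, j') ∈ ones

namespace TypeBTableau

variable {n : ℕ}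

/-- The number of rows, not counting the added rows. -/
def row (T : TypeBTableau n) : ℕ := T.shape.rows.length

/-- The number of ones in diagonal cells. -/
def diag (T : TypeBTableau n) : ℕ := {i ∈ Finset.range T.shape.cols | (i, i) ∈ T.ones}.card

open Classical in
/-- The number of superfluous ones, that is, ones with a `1` above them in the same column. -/
noncomputable def so (T : TypeBTableau n) : ℕ :=
  {c ∈ T.ones | ∃ i' < c.1, (i', c.2) ∈ T.ones}.card

/-- There are finitely many type `B` permutation tableaux of length `n`. -/
theorem finite_tableaux (n : ℕ) : Finite (TypeBTableau n) := by
  have h1 : (List.map Fin.val '' {l : List (Fin (n + 1)) | l.length ≤ n}).Finite :=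
    (List.finite_length_le (Fin (n + 1)) n).image _
  have h2 := (h1.prod (Set.finite_Iic n)).prod
    (Finset.finite_toSet (Finset.range n ×ˢ Finset.range n).powerset)
  let f : TypeBTableau n → (List ℕ × ℕ) × Finset (ℕ × ℕ) :=
    fun T => ((T.shape.rows, T.shape.cols), T.ones)
  have hf : Function.Injective f := by
    rintro ⟨⟨r, k, _, _⟩, _, o, _, _, _, _⟩ ⟨⟨r', k', _, _⟩, _, o', _, _, _, _⟩ h
    simp only [f, Prod.mk.injEq] at h
    obtain ⟨⟨rfl, rfl⟩, rfl⟩ := h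
    rfl
  refine Set.finite_univ_iff.mp (Set.Finite.of_finite_image (f := f) (h2.subset ?_) hf.injOn)
  rintro _ ⟨T, -, rfl⟩
  have hl := T.length_eq
  unfold FerrersDiagram.length at hl
  refine ⟨⟨⟨T.shape.rows.attach.map fun m => ⟨m.1, ?_⟩, ?_, ?_⟩, ?_⟩, ?_⟩
  · have := T.shape.le_cols m.1 m.2
    omega
  · simp only [Set.mem_ofPred_eq, List.length_map, List.length_attach]
    omega
  · simp [f, List.map_map, Function.comp_def]
  · simp only [Set.mem_Iic, f]
    omega
  · simp only [f, Finset.mem_coe, Finset.mem_powerset]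
    intro c hc
    have := T.ones_subset hc
    simp only [FerrersDiagram.shiftedCells, FerrersDiagram.shiftedRows, Finset.mem_filter,
      Finset.mem_product, Finset.mem_range, List.length_append, List.length_range'] at this ⊢
    omega

noncomputable instance : Fintype (TypeBTableau n) :=
  @Fintype.ofFinite _ (finite_tableaux n)

end TypeBTableau

/-- `B_n(y, t, q)`, the generating polynomial of type `B` permutation tableaux of length `n`. -/
noncomputable def typeBPolynomial {A : Type*} [CommRing A] (n : ℕ) (y t q : A) : A :=
  ∑ T : TypeBTableau n, y ^ (2 * T.row + T.diag) * t ^ T.diag * q ^ T.so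

/-- The `q`-integer `[n]_q = 1 + q + ⋯ + q ^ (n - 1)`. -/
def qInt {R : Type*} [CommRing R] (q : R) (n : ℕ) : R := ∑ i ∈ Finset.range n, q ^ i

/-- The `q`-derivative: the `R`-linear operator on `R[t]` that sends `t ^ n` to `[n]_q t ^ (n - 1)`
(and `1` to `0`, as `[0]_q = 0`). -/
noncomputable def qDeriv {R : Type*} [CommRing R] (q : R) :
    Polynomial R →ₗ[R] Polynomial R :=
  Polynomial.lsum fun n => qInt q n • Polynomial.monomial (n - 1)

/-! Every tableau of length `n + 1` arises uniquely from one of length `n` by adding an empty row at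
the bottom or a full column at the left (`extend_bijective`). The ones of a new column may sit
exactly in the new top row, whose only cell is diagonal, and in unrestricted old rows. After the
addition, the unrestricted rows are the rows holding a new one, together with the previously
unrestricted rows above all the new ones. Hence the number `u` of unrestricted rows suffices to
control the growth: summing `h u` against the weights gives the recursion `sum_weight_succ`, with
the operator `transfer` acting on `h`.

The algebraic side realizes this operator on `R[t]`. Let `D f = D_q ((1 + y t) f)`. If `y ^ s * h s
= D ^ s v` for all `s`, then `transfer h` is related in the same way to `(y + t) D v`
(`pow_mul_transfer`). This comes from moving `D ^ u` past multiplication by `t`, using `D (t f) = t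
(y + q D) f + f`: the three resulting terms match a new row, a column with a one on the diagonal,
and a column with a zero there. Since `D ^ u 1 = y ^ u`, the constant function `1` corresponds to `v
= 1`; evaluating at `u = 0` gives the theorem. -/

/-- The `q`-binomial-type transform `∑ s, (u choose s) q ^ s h s`, given by its Pascal recursion. -/
def subsetSum {A : Type*} [CommRing A] (q : A) : ℕ → (ℕ → A) → A
  | 0, h => h 0
  | u + 1, h => subsetSum q u h + q * subsetSum q u fun s => h (s + 1)

/-- The sum over nonempty subsets `S` of `{1, …, u}` of `q ^ (|S| - 1)` times `h` at the number of
elements that are in `S` or smaller than all elements of `S`, given recursively. -/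
def nonemptySubsetSum {A : Type*} [CommRing A] (q : A) : ℕ → (ℕ → A) → A
  | 0, _ => 0
  | u + 1, h => nonemptySubsetSum q u (fun s => h (s + 1)) + subsetSum q u fun s => h (s + 1)

/-- The transfer operator for lengthening a tableau by one row or column, acting on functions of
the number of unrestricted rows. -/
def transfer {A : Type*} [CommRing A] (y t q : A) (h : ℕ → A) (u : ℕ) : A :=
  y ^ 2 * h (u + 1) + y * t * subsetSum q u (fun s => h (s + 1)) + nonemptySubsetSum q u h

/-! ### The operator `D_q (1 + y t)` and its commutation with `t` -/

section Algebra

variable {R : Type*} [CommRing R]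

open Polynomial

theorem qDeriv_monomial (q : R) (n : ℕ) (a : R) :
    qDeriv q (monomial n a) = monomial (n - 1) (qInt q n * a) := by
  simp [qDeriv, Polynomial.lsum_apply, Polynomial.sum_monomial_index, smul_monomial]

theorem qInt_succ (q : R) (n : ℕ) : qInt q (n + 1) = q * qInt q n + 1 := by
  simp [qInt, Finset.sum_range_succ', Finset.mul_sum, pow_succ']

theorem qDeriv_X_mul (q : R) (f : R[X]) : qDeriv q (X * f) = C q * (X * qDeriv q f) + f := by
  induction f using Polynomial.induction_on' with
  | add f g hf hg => rw [mul_add, map_add, hf, hg, map_add]; ring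
  | monomial n a =>
    rw [X_mul_monomial, qDeriv_monomial, qDeriv_monomial, qInt_succ]
    rcases n with _ | n
    · simp [qInt]
    · rw [X_mul_monomial, C_mul_monomial]
      simp only [Nat.add_sub_cancel]
      rw [← map_add]
      congr 1
      ring

/-- The operator `f ↦ D_q ((1 + y t) f)`. -/
noncomputable def qDerivMul (y q : R) : R[X] →ₗ[R] R[X] :=
  qDeriv q ∘ₗ LinearMap.mulLeft R (1 + C y * X)

theorem qDerivMul_apply (y q : R) (f : R[X]) :
    qDerivMul y q f = qDeriv q ((1 + C y * X) * f) := rfl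

theorem qDeriv_C_mul (q a : R) (f : R[X]) : qDeriv q (C a * f) = C a * qDeriv q f := by
  rw [← smul_eq_C_mul, map_smul, smul_eq_C_mul]

theorem qDerivMul_C_mul (y q a : R) (f : R[X]) :
    qDerivMul y q (C a * f) = C a * qDerivMul y q f := by
  rw [← smul_eq_C_mul, map_smul, smul_eq_C_mul]

theorem qDerivMul_X_mul (y q : R) (f : R[X]) :
    qDerivMul y q (X * f) = X * (C y * f + C q * qDerivMul y q f) + f := by
  have h1 : (1 + C y * X) * (X * f) = X * f + C y * (X * (X * f)) := by ring
  have h2 : (1 + C y * X) * f = f + C y * (X * f) := by ring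
  rw [qDerivMul_apply, qDerivMul_apply, h1, h2]
  simp only [map_add, qDeriv_C_mul, qDeriv_X_mul]
  ring

theorem qDerivMul_one (y q : R) : qDerivMul y q 1 = C y := by
  have h : (1 + C y * X) * 1 = monomial 0 1 + monomial 1 y := by
    rw [← C_mul_X_eq_monomial]; simp
  rw [qDerivMul_apply, h, map_add, qDeriv_monomial, qDeriv_monomial]
  simp [qInt]

theorem qDerivMul_iterate_one (y q : R) (u : ℕ) : (qDerivMul y q)^[u] 1 = C y ^ u := by
  induction u with
  | zero => rfl
  | succ u ih =>
    rw [Function.iterate_succ_apply', ih, ← C_pow, ← mul_one (C (y ^ u)), qDerivMul_C_mul,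
      qDerivMul_one, C_pow, pow_succ]

/-- The operator `y + q D_q (1 + y t)`. -/
noncomputable def addQDerivMul (y q : R) (f : R[X]) : R[X] := C y * f + C q * qDerivMul y q f

/-- The sum of `D ^ (i + 1) (y + q D) ^ (u - 1 - i)` over `i < u`, where `D = D_q (1 + y t)`. -/
noncomputable def mixedSum (y q : R) : ℕ → R[X] → R[X]
  | 0, _ => 0
  | u + 1, f => mixedSum y q u (qDerivMul y q f) + (addQDerivMul y q)^[u] (qDerivMul y q f)

theorem addQDerivMul_comm (y q : R) : Function.Commute (qDerivMul y q) (addQDerivMul y q) := by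
  intro f
  simp only [addQDerivMul, map_add, qDerivMul_C_mul]

theorem qDerivMul_mixedSum (y q : R) (u : ℕ) (f : R[X]) :
    qDerivMul y q (mixedSum y q u f) = mixedSum y q u (qDerivMul y q f) := by
  induction u generalizing f with
  | zero => simp [mixedSum]
  | succ u ih =>
    rw [mixedSum, mixedSum, map_add, ih, ((addQDerivMul_comm y q).iterate_right u).eq]

/-- Each time `D` passes `X`, it either turns into `y + q D` or is absorbed together with `X`;
`mixedSum` collects the terms in which `X` has been absorbed. -/
theorem qDerivMul_iterate_X_mul (y q : R) (u : ℕ) (f : R[X]) :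
    (qDerivMul y q)^[u] (X * qDerivMul y q f) =
      X * (addQDerivMul y q)^[u] (qDerivMul y q f) + mixedSum y q u f := by
  induction u with
  | zero => simp [mixedSum]
  | succ u ih =>
    rw [Function.iterate_succ_apply', ih, map_add, qDerivMul_X_mul, qDerivMul_mixedSum, mixedSum,
      Function.iterate_succ_apply' (addQDerivMul y q)]
    simp only [addQDerivMul]
    ring

/-- Pascal's recursion expands `(y + q D) ^ u`. The offset `j` keeps the hypothesis stable under the
shift of `h`, so that `y` need not be cancelled. -/
theorem pow_mul_subsetSum (y q : R) (v : R[X]) (h : ℕ → R[X]) (j u : ℕ)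
    (hv : ∀ s, C y ^ (s + j) * h s = (qDerivMul y q)^[s] v) :
    C y ^ (u + j) * subsetSum (C q) u h = (addQDerivMul y q)^[u] v := by
  induction u generalizing h j v with
  | zero => simpa [subsetSum] using hv 0
  | succ u ih =>
    have h1 := ih v h j hv
    have h2 := ih (qDerivMul y q v) (fun s => h (s + 1)) (j + 1) fun s => by
      rw [← Function.iterate_succ_apply, ← hv (s + 1)]; ring
    rw [Function.iterate_succ_apply', subsetSum, addQDerivMul,
      ((addQDerivMul_comm y q).iterate_right u).eq, ← h1, ← h2]
    ring

/-- The summand `D ^ (i + 1) (y + q D) ^ (u - 1 - i)` corresponds to the sets whose least element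
has `i` elements below it. -/
theorem pow_mul_nonemptySubsetSum (y q : R) (v : R[X]) (h : ℕ → R[X]) (j u : ℕ)
    (hv : ∀ s, C y ^ (s + j) * h s = (qDerivMul y q)^[s] v) :
    C y ^ (u + j) * nonemptySubsetSum (C q) u h = mixedSum y q u v := by
  induction u generalizing h j v with
  | zero => simp [nonemptySubsetSum, mixedSum]
  | succ u ih =>
    have hv' : ∀ s, C y ^ (s + (j + 1)) * h (s + 1) = (qDerivMul y q)^[s] (qDerivMul y q v) :=
      fun s => by rw [← Function.iterate_succ_apply, ← hv (s + 1)]; ring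
    rw [nonemptySubsetSum, mixedSum, ← ih _ _ (j + 1) hv', ← pow_mul_subsetSum y q _ _ (j + 1) u hv']
    ring

theorem pow_mul_transfer (y q : R) (v : R[X]) (h : ℕ → R[X])
    (hv : ∀ s, C y ^ s * h s = (qDerivMul y q)^[s] v) (u : ℕ) :
    C y ^ u * transfer (C y) X (C q) h u =
      (qDerivMul y q)^[u] ((C y + X) * qDerivMul y q v) := by
  have hv' : ∀ s, C y ^ (s + 1) * h (s + 1) = (qDerivMul y q)^[s] (qDerivMul y q v) :=
    fun s => by rw [← Function.iterate_succ_apply, ← hv (s + 1)]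
  have hC : (qDerivMul y q)^[u] (C y * qDerivMul y q v) =
      C y * (qDerivMul y q)^[u] (qDerivMul y q v) := by
    have : Function.Commute (qDerivMul y q) (C y * ·) := fun f => qDerivMul_C_mul y q y f
    exact (this.iterate_left u).eq _
  rw [add_mul, ← Module.End.pow_apply, map_add, Module.End.pow_apply, Module.End.pow_apply, hC,
    qDerivMul_iterate_X_mul, ← hv', ← pow_mul_subsetSum y q _ (fun s => h (s + 1)) 1 u hv',
    ← pow_mul_nonemptySubsetSum y q v h 0 u hv, transfer]
  ring

theorem pow_mul_transfer_iterate (y q : R) (n u : ℕ) :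
    C y ^ u * (transfer (C y) X (C q))^[n] 1 u =
      (qDerivMul y q)^[u] ((fun f => (C y + X) * qDerivMul y q f)^[n] 1) := by
  induction n generalizing u with
  | zero => simp [qDerivMul_iterate_one]
  | succ n ih =>
    rw [Function.iterate_succ_apply', Function.iterate_succ_apply']
    exact pow_mul_transfer y q _ _ ih u

end Algebra

/-! ### Sums over subsets in terms of cardinality -/

section SubsetSums

variable {A : Type*} [CommRing A]

theorem sum_powerset_eq_subsetSum (q : A) (U : Finset ℕ) (h : ℕ → A) :
    ∑ S ∈ U.powerset, q ^ S.card * h S.card = subsetSum q U.card h := by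
  induction U using Finset.induction_on generalizing h with
  | empty => simp [subsetSum]
  | insert a U ha ih =>
    rw [Finset.sum_powerset_insert ha, Finset.card_insert_of_notMem ha, subsetSum, ← ih, ← ih,
      Finset.mul_sum]
    congr 1
    refine Finset.sum_congr rfl fun S hS => ?_
    rw [Finset.card_insert_of_notMem fun h => ha (Finset.mem_powerset.mp hS h)]
    ring

/-- The elements of `U` that are in `S` or smaller than all elements of `S`. -/
def survivors (U S : Finset ℕ) : Finset ℕ := {i ∈ U | i ∈ S ∨ ∀ s ∈ S, i < s}

/-- The least element `a` of the ground set decides: if `a ∉ S`, it survives and the rest is as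
before; if `a ∈ S`, nothing lies below it, so the survivors are `S` itself and the rest of `S` is
arbitrary. -/
theorem sum_powerset_eq_nonemptySubsetSum (q : A) (U : Finset ℕ) (h : ℕ → A) :
    ∑ S ∈ U.powerset with S.Nonempty, q ^ (S.card - 1) * h (survivors U S).card =
      nonemptySubsetSum q U.card h := by
  induction U using Finset.induction_on_min generalizing h with
  | empty => simp [nonemptySubsetSum, Finset.filter_singleton]
  | insert a U hlt ih =>
    have ha : a ∉ U := fun h => (hlt a h).false
    rw [Finset.sum_filter, Finset.sum_powerset_insert ha, Finset.card_insert_of_notMem ha,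
      nonemptySubsetSum, ← ih, Finset.sum_filter, ← sum_powerset_eq_subsetSum]
    congr 1
    · refine Finset.sum_congr rfl fun S hS => ?_
      rw [Finset.mem_powerset] at hS
      have : survivors (insert a U) S = insert a (survivors U S) := by
        rw [survivors, Finset.filter_insert, if_pos (Or.inr fun s hs => hlt s (hS hs)), survivors]
      have ha' : a ∉ survivors U S := fun h => ha (Finset.mem_filter.mp h).1
      rw [this, Finset.card_insert_of_notMem ha']
    · refine Finset.sum_congr rfl fun S hS => ?_
      rw [Finset.mem_powerset] at hS
      have haS : a ∉ S := fun h => ha (hS h)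
      have : survivors (insert a U) (insert a S) = insert a S := by
        ext i
        simp only [survivors, Finset.mem_filter, Finset.mem_insert, forall_eq_or_imp]
        constructor
        · rintro ⟨rfl | hi, h | ⟨h, -⟩⟩
          · exact h
          · exact Or.inl rfl
          · exact h
          · exact absurd h (hlt i hi).le.not_gt
        · rintro (rfl | hi)
          · exact ⟨Or.inl rfl, Or.inl (Or.inl rfl)⟩
          · exact ⟨Or.inr (hS hi), Or.inl (Or.inr hi)⟩
      rw [if_pos (Finset.insert_nonempty a S), this, Finset.card_insert_of_notMem haS,
        Nat.add_sub_cancel]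

end SubsetSums

/-! ### Growing a Ferrers diagram by a row or a column -/

namespace FerrersDiagram

theorem mem_shiftedCells (F : FerrersDiagram) (i j : ℕ) :
    (i, j) ∈ F.shiftedCells ↔ j < F.shiftedRows.getD i 0 := by
  simp only [shiftedCells, Finset.mem_filter, Finset.mem_product, Finset.mem_range,
    and_iff_right_iff_imp]
  intro h
  have hi : i < F.shiftedRows.length := by
    by_contra hi
    rw [List.getD_eq_default _ _ (not_lt.mp hi)] at h
    exact absurd h (Nat.not_lt_zero j)
  refine ⟨hi, h.trans_le ?_⟩
  rw [List.getD_eq_getElem _ _ hi]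
  have hm := List.getElem_mem hi
  generalize F.shiftedRows[i] = m at hm
  rw [shiftedRows, List.mem_append, List.mem_range'] at hm
  rcases hm with ⟨l, hl, rfl⟩ | hm
  · omega
  · exact F.le_cols m hm

theorem length_shiftedRows (F : FerrersDiagram) : F.shiftedRows.length = F.length := by
  simp [shiftedRows, length, add_comm]

theorem lt_length_of_mem {F : FerrersDiagram} {i j : ℕ} (h : (i, j) ∈ F.shiftedCells) :
    i < F.length := by
  have := (Finset.mem_product.mp (Finset.mem_filter.mp h).1).1
  rwa [Finset.mem_range, length_shiftedRows] at this

/-- Adding an empty row at the bottom. -/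
def addRow (F : FerrersDiagram) : FerrersDiagram where
  rows := F.rows ++ [0]
  cols := F.cols
  sorted := by simp [List.pairwise_append, F.sorted]
  le_cols := by
    simp only [List.mem_append, List.mem_singleton]
    rintro m (h | rfl)
    · exact F.le_cols m h
    · exact Nat.zero_le _

/-- Adding a full column at the left. -/
def addCol (F : FerrersDiagram) : FerrersDiagram where
  rows := F.rows.map (· + 1)
  cols := F.cols + 1
  sorted := by simpa [List.pairwise_map] using F.sorted
  le_cols := by
    simp only [List.mem_map]
    rintro _ ⟨m, h, rfl⟩
    exact Nat.succ_le_succ (F.le_cols m h)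

theorem length_addRow (F : FerrersDiagram) : F.addRow.length = F.length + 1 := by
  simp only [length, addRow, List.length_append, List.length_singleton]; omega

theorem length_addCol (F : FerrersDiagram) : F.addCol.length = F.length + 1 := by
  simp only [length, addCol, List.length_map]; omega

/-- This makes the old cell `(i, j)` become `(i + 1, j + 1)`, so diagonal cells stay diagonal and
the new top row has one cell. -/
theorem shiftedRows_addCol (F : FerrersDiagram) :
    F.addCol.shiftedRows = 1 :: F.shiftedRows.map (· + 1) := by
  simp only [shiftedRows, addCol, List.map_append]
  rw [List.range'_succ, List.cons_append]
  congr 2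
  rw [List.range'_eq_map_range, List.range'_eq_map_range, List.map_map]
  exact List.map_congr_left fun x _ => by simp; omega

theorem shiftedCells_addRow (F : FerrersDiagram) : F.addRow.shiftedCells = F.shiftedCells := by
  ext ⟨i, j⟩
  rw [mem_shiftedCells, mem_shiftedCells]
  have : F.addRow.shiftedRows = F.shiftedRows ++ [0] := by simp [shiftedRows, addRow]
  rw [this]
  rcases lt_or_ge i F.shiftedRows.length with h | h
  · rw [List.getD_append _ _ _ _ h]
  · rw [List.getD_append_right _ _ _ _ h, List.getD_eq_default _ _ h]
    -- The length is `0` both in the new row and, by default, beyond it.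
    rcases i - F.shiftedRows.length with _ | k <;> simp

theorem zero_mem_shiftedCells_addCol (F : FerrersDiagram) (j : ℕ) :
    (0, j) ∈ F.addCol.shiftedCells ↔ j = 0 := by
  rw [mem_shiftedCells, shiftedRows_addCol]; simp

theorem mem_shiftedCells_addCol_zero (F : FerrersDiagram) (i : ℕ) :
    (i, 0) ∈ F.addCol.shiftedCells ↔ i < F.length + 1 := by
  rw [mem_shiftedCells, shiftedRows_addCol, ← length_shiftedRows]
  rcases i with _ | i
  · simp
  · rcases lt_or_ge i F.shiftedRows.length with h | h
    · simp [h]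
    · simp [h]

theorem succ_mem_shiftedCells_addCol (F : FerrersDiagram) (i j : ℕ) :
    (i + 1, j + 1) ∈ F.addCol.shiftedCells ↔ (i, j) ∈ F.shiftedCells := by
  rw [mem_shiftedCells, mem_shiftedCells, shiftedRows_addCol]
  rcases lt_or_ge i F.shiftedRows.length with h | h
  · simp [h]
  · simp [h]

/-- A nonempty Ferrers diagram has an empty last row or a full first column. -/
theorem exists_eq_addRow_or_addCol (F : FerrersDiagram) (h : F.length ≠ 0) :
    (∃ G : FerrersDiagram, F = G.addRow) ∨ ∃ G : FerrersDiagram, F = G.addCol := by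
  obtain ⟨rows, cols, hs, hc⟩ := F
  by_cases h0 : 0 ∈ rows
  · left
    rcases rows.eq_nil_or_concat with rfl | ⟨l, a, rfl⟩
    · simp at h0
    · have hs' := hs
      simp only [List.concat_eq_append, List.pairwise_append, List.mem_singleton, forall_eq] at hs'
      -- Row lengths weakly decrease, so a zero anywhere forces the last one to be zero.
      obtain rfl : a = 0 := by
        simp only [List.concat_eq_append, List.mem_append, List.mem_singleton] at h0
        rcases h0 with h0 | h0
        · exact Nat.le_zero.mp (hs'.2.2 0 h0)
        · exact h0.symm
      exact ⟨⟨l, cols, hs'.1, fun m hm => hc m (by simp [hm])⟩, by simp [addRow]⟩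
  · right
    have hpos : ∀ m ∈ rows, 0 < m := fun m hm =>
      Nat.pos_of_ne_zero fun h' => h0 (h' ▸ hm)
    rcases cols with _ | k
    · rcases rows with _ | ⟨m, rows⟩
      · simp [length] at h
      · exact absurd (hc m (by simp)) (hpos m (by simp)).not_ge
    · have hmap : (rows.map (· - 1)).map (· + 1) = rows := by
        rw [List.map_map]
        conv_rhs => rw [← List.map_id rows]
        exact List.map_congr_left fun m hm => Nat.sub_add_cancel (hpos m hm)
      refine ⟨⟨rows.map (· - 1), k, ?_, ?_⟩, ?_⟩
      · rw [List.pairwise_map]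
        exact hs.imp fun h => Nat.sub_le_sub_right h 1
      · simp only [List.mem_map]
        rintro _ ⟨m, hm, rfl⟩
        have := hc m hm
        omega
      · simp [addCol, hmap]

end FerrersDiagram

/-! ### Unrestricted rows and the growth of tableaux -/

namespace TypeBTableau

variable {n : ℕ}

@[ext]
theorem ext {T T' : TypeBTableau n} (h : T.shape = T'.shape) (h' : T.ones = T'.ones) : T = T' := by
  cases T; cases T'; congr

open Classical in
/-- The unrestricted rows, counted from the top of the shifted diagram: those without a `0` that has
a `1` above it and without a `0` in a diagonal cell. -/
noncomputable def unrestricted (T : TypeBTableau n) : Finset ℕ :=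
  {i ∈ Finset.range n | (∀ j, (i, j) ∈ T.shape.shiftedCells → (i, j) ∉ T.ones →
    ∀ i' < i, (i', j) ∉ T.ones) ∧ (i < T.shape.cols → (i, i) ∈ T.ones)}

theorem mem_unrestricted {T : TypeBTableau n} {i : ℕ} : i ∈ T.unrestricted ↔
    i < n ∧ (∀ j, (i, j) ∈ T.shape.shiftedCells → (i, j) ∉ T.ones →
      ∀ i' < i, (i', j) ∉ T.ones) ∧ (i < T.shape.cols → (i, i) ∈ T.ones) := by
  simp [unrestricted]

theorem lt_of_mem_ones {T : TypeBTableau n} {i j : ℕ} (h : (i, j) ∈ T.ones) : i < n :=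
  T.length_eq ▸ FerrersDiagram.lt_length_of_mem (T.ones_subset h)

/-- Adding an empty row at the bottom of a tableau. -/
def addRow (T : TypeBTableau n) : TypeBTableau (n + 1) where
  shape := T.shape.addRow
  length_eq := by rw [FerrersDiagram.length_addRow, T.length_eq]
  ones := T.ones
  ones_subset := by rw [FerrersDiagram.shiftedCells_addRow]; exact T.ones_subset
  column_has_one := T.column_has_one
  zero_condition := by rw [FerrersDiagram.shiftedCells_addRow]; exact T.zero_condition
  diagonal_condition := T.diagonal_condition

/-- The cells of the ones after a column with set of ones `S` has been added at the left. -/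
def addColOnes (O : Finset (ℕ × ℕ)) (S : Finset ℕ) : Finset (ℕ × ℕ) :=
  S ×ˢ {0} ∪
    O.map ⟨Prod.map Nat.succ Nat.succ, Nat.succ_injective.prodMap Nat.succ_injective⟩

theorem mem_addColOnes_zero {O : Finset (ℕ × ℕ)} {S : Finset ℕ} {i : ℕ} :
    (i, 0) ∈ addColOnes O S ↔ i ∈ S := by
  simp [addColOnes]

theorem zero_succ_notMem_addColOnes {O : Finset (ℕ × ℕ)} {S : Finset ℕ} {j : ℕ} :
    (0, j + 1) ∉ addColOnes O S := by
  simp [addColOnes]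

theorem succ_mem_addColOnes {O : Finset (ℕ × ℕ)} {S : Finset ℕ} {i j : ℕ} :
    (i + 1, j + 1) ∈ addColOnes O S ↔ (i, j) ∈ O := by
  simp [addColOnes]

/-- A nonempty set of unrestricted rows of `T`, shifted by one, possibly together with the new
top row `0`. -/
structure IsColumnChoice (T : TypeBTableau n) (S : Finset ℕ) : Prop where
  nonempty : S.Nonempty
  mem_unrestricted : ∀ i, i + 1 ∈ S → i ∈ T.unrestricted

/-- Adding a full column at the left of a tableau, with ones in the rows in `S`. -/
def addCol (T : TypeBTableau n) (S : Finset ℕ) (hS : T.IsColumnChoice S) :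
    TypeBTableau (n + 1) where
  shape := T.shape.addCol
  length_eq := by rw [FerrersDiagram.length_addCol, T.length_eq]
  ones := addColOnes T.ones S
  ones_subset := by
    rintro ⟨_ | i, _ | j⟩ h
    · exact (FerrersDiagram.zero_mem_shiftedCells_addCol _ _).mpr rfl
    · exact absurd h zero_succ_notMem_addColOnes
    · rw [FerrersDiagram.mem_shiftedCells_addCol_zero, T.length_eq]
      exact Nat.succ_lt_succ
        (TypeBTableau.mem_unrestricted.mp (hS.mem_unrestricted i (mem_addColOnes_zero.mp h))).1
    · rw [FerrersDiagram.succ_mem_shiftedCells_addCol]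
      exact T.ones_subset (succ_mem_addColOnes.mp h)
  column_has_one := by
    rintro (_ | j) hj
    · obtain ⟨i, hi⟩ := hS.nonempty
      exact ⟨i, mem_addColOnes_zero.mpr hi⟩
    · obtain ⟨i, hi⟩ := T.column_has_one j (Nat.lt_of_succ_lt_succ hj)
      exact ⟨i + 1, succ_mem_addColOnes.mpr hi⟩
  zero_condition := by
    rintro (_ | i) (_ | j) hc h0 ⟨⟨i', hi, hi'⟩, j', hj, hj'⟩
    · exact absurd hi (Nat.not_lt_zero _)
    · exact absurd hi (Nat.not_lt_zero _)
    · exact absurd hj (Nat.not_lt_zero _)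
    · rw [FerrersDiagram.succ_mem_shiftedCells_addCol] at hc
      rw [succ_mem_addColOnes] at h0
      rcases i' with _ | i'
      · exact zero_succ_notMem_addColOnes hi'
      rw [succ_mem_addColOnes] at hi'
      -- A one to the left in the new column is harmless because its row is unrestricted; any other
      -- is handled by the condition on `T`.
      rcases j' with _ | j'
      · exact (TypeBTableau.mem_unrestricted.mp (hS.mem_unrestricted i
          (mem_addColOnes_zero.mp hj'))).2.1 j hc h0 i' (Nat.lt_of_succ_lt_succ hi) hi'
      · exact T.zero_condition i j hc h0 ⟨⟨i', Nat.lt_of_succ_lt_succ hi, hi'⟩, j',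
          Nat.lt_of_succ_lt_succ hj, succ_mem_addColOnes.mp hj'⟩
  diagonal_condition := by
    rintro (_ | i) hi h0 ⟨j', hj, hj'⟩
    · exact absurd hj (Nat.not_lt_zero _)
    · rw [succ_mem_addColOnes] at h0
      have hi := Nat.lt_of_succ_lt_succ hi
      rcases j' with _ | j'
      · exact h0 ((TypeBTableau.mem_unrestricted.mp (hS.mem_unrestricted i
          (mem_addColOnes_zero.mp hj'))).2.2 hi)
      · exact T.diagonal_condition i hi h0
          ⟨j', Nat.lt_of_succ_lt_succ hj, succ_mem_addColOnes.mp hj'⟩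

theorem unrestricted_addRow (T : TypeBTableau n) :
    T.addRow.unrestricted = insert n T.unrestricted := by
  ext i
  rw [Finset.mem_insert, mem_unrestricted, mem_unrestricted]
  change (i < n + 1 ∧ (∀ j, (i, j) ∈ T.shape.addRow.shiftedCells → (i, j) ∉ T.ones → _) ∧
    (i < T.shape.cols → (i, i) ∈ T.ones)) ↔ _
  rw [FerrersDiagram.shiftedCells_addRow]
  constructor
  · rintro ⟨h1, h2⟩
    exact (Nat.lt_succ_iff_lt_or_eq.mp h1).symm.imp_right fun h => ⟨h, h2⟩
  · rintro (rfl | ⟨h1, h2⟩)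
    -- The new row `n` has no cells and is not an added row, since the number of columns is at most
    -- `n`.
    · refine ⟨Nat.lt_succ_self _, fun j hj => ?_, fun hi => ?_⟩
      · have := FerrersDiagram.lt_length_of_mem hj
        rw [T.length_eq] at this
        exact absurd this (lt_irrefl _)
      · have := T.length_eq
        unfold FerrersDiagram.length at this
        omega
    · exact ⟨h1.trans (Nat.lt_succ_self n), h2⟩

theorem card_unrestricted_addRow (T : TypeBTableau n) :
    T.addRow.unrestricted.card = T.unrestricted.card + 1 := by
  rw [unrestricted_addRow, Finset.card_insert_of_notMem]
  exact fun h => (mem_unrestricted.mp h).1.false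

theorem mem_unrestricted_addCol (T : TypeBTableau n) (S : Finset ℕ) (hS : T.IsColumnChoice S)
    (i : ℕ) : i ∈ (T.addCol S hS).unrestricted ↔
      i ∈ S ∨ i ∈ T.unrestricted.map ⟨Nat.succ, Nat.succ_injective⟩ ∧ ∀ s ∈ S, i < s := by
  rw [mem_unrestricted]
  change (i < n + 1 ∧ (∀ j, (i, j) ∈ T.shape.addCol.shiftedCells → (i, j) ∉ addColOnes T.ones S →
    ∀ i' < i, (i', j) ∉ addColOnes T.ones S) ∧
      (i < T.shape.cols + 1 → (i, i) ∈ addColOnes T.ones S)) ↔ _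
  rcases i with _ | i
  · simp [mem_addColOnes_zero]
  · simp only [Finset.mem_map, Function.Embedding.coeFn_mk, Nat.succ_eq_add_one, Nat.add_right_cancel_iff,
      exists_eq_right, succ_mem_addColOnes]
    constructor
    · rintro ⟨h1, h2, h3⟩
      by_cases hi : i + 1 ∈ S
      · exact Or.inl hi
      refine Or.inr ⟨mem_unrestricted.mpr ⟨Nat.lt_of_succ_lt_succ h1, fun j hc h0 i' hi' => ?_,
        fun h => h3 (Nat.succ_lt_succ h)⟩, fun s hs => ?_⟩
      · have := h2 (j + 1) ((FerrersDiagram.succ_mem_shiftedCells_addCol _ _ _).mpr hc)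
          (fun h => h0 (succ_mem_addColOnes.mp h)) (i' + 1) (Nat.succ_lt_succ hi')
        exact fun h => this (succ_mem_addColOnes.mpr h)
      · rcases lt_trichotomy (i + 1) s with h | rfl | h
        · exact h
        · exact absurd hs hi
        -- Otherwise the zero of this row in the new column would have the one of row `s` above it.
        · refine absurd (mem_addColOnes_zero.mpr hs) (h2 0 ?_ ?_ s h)
          · rwa [FerrersDiagram.mem_shiftedCells_addCol_zero, T.length_eq]
          · rwa [mem_addColOnes_zero]
    · intro h
      have hU : i ∈ T.unrestricted := h.elim (hS.mem_unrestricted i) And.left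
      obtain ⟨h1, h2, h3⟩ := mem_unrestricted.mp hU
      refine ⟨Nat.succ_lt_succ h1, fun j hc h0 i' hi' => ?_,
        fun hi => h3 (Nat.lt_of_succ_lt_succ hi)⟩
      rcases j with _ | j
      · rw [mem_addColOnes_zero] at h0 ⊢
        exact fun hs => ((h.resolve_left h0).2 i' hs).not_gt hi'
      · rw [FerrersDiagram.succ_mem_shiftedCells_addCol] at hc
        rw [succ_mem_addColOnes] at h0
        rcases i' with _ | i'
        · exact zero_succ_notMem_addColOnes
        · rw [succ_mem_addColOnes]
          exact h2 j hc h0 i' (Nat.lt_of_succ_lt_succ hi')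

theorem unrestricted_addCol_of_zero_mem (T : TypeBTableau n) (S : Finset ℕ)
    (hS : T.IsColumnChoice S) (h0 : 0 ∈ S) : (T.addCol S hS).unrestricted = S := by
  ext i
  rw [mem_unrestricted_addCol]
  exact or_iff_left fun h => Nat.not_lt_zero _ (h.2 0 h0)

theorem unrestricted_addCol_of_zero_notMem (T : TypeBTableau n) (S : Finset ℕ)
    (hS : T.IsColumnChoice S) (h0 : 0 ∉ S) : (T.addCol S hS).unrestricted =
      survivors (T.unrestricted.map ⟨Nat.succ, Nat.succ_injective⟩) S := by
  ext i
  rw [mem_unrestricted_addCol, survivors, Finset.mem_filter]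
  constructor
  · rintro (h | ⟨h1, h2⟩)
    · refine ⟨?_, Or.inl h⟩
      rcases i with _ | i
      · exact absurd h h0
      · exact Finset.mem_map.mpr ⟨i, hS.mem_unrestricted i h, rfl⟩
    · exact ⟨h1, Or.inr h2⟩
  · rintro ⟨h1, h | h⟩
    · exact Or.inl h
    · exact Or.inr ⟨h1, h⟩

/-! ### Change of the statistics -/

theorem row_addRow (T : TypeBTableau n) : T.addRow.row = T.row + 1 := by
  simp [row, addRow, FerrersDiagram.addRow]

theorem row_addCol (T : TypeBTableau n) (S : Finset ℕ) (hS : T.IsColumnChoice S) :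
    (T.addCol S hS).row = T.row := by
  simp [row, addCol, FerrersDiagram.addCol]

theorem diag_addCol (T : TypeBTableau n) (S : Finset ℕ) (hS : T.IsColumnChoice S) :
    (T.addCol S hS).diag = T.diag + if 0 ∈ S then 1 else 0 := by
  simp only [diag, Finset.card_filter]
  change ∑ i ∈ Finset.range (T.shape.cols + 1),
    (if (i, i) ∈ addColOnes T.ones S then 1 else 0) = _
  simp only [Finset.sum_range_succ', succ_mem_addColOnes, mem_addColOnes_zero]

-- In the new column, all ones but the topmost are superfluous. The older columns gain no one, as
-- the new top row does not reach them.
open Classical in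
theorem so_addCol (T : TypeBTableau n) (S : Finset ℕ) (hS : T.IsColumnChoice S) :
    (T.addCol S hS).so = T.so + (S.card - 1) := by
  have h : {c ∈ addColOnes T.ones S | ∃ i' < c.1, (i', c.2) ∈ addColOnes T.ones S} =
      addColOnes {c ∈ T.ones | ∃ i' < c.1, (i', c.2) ∈ T.ones} (S.erase (S.min' hS.nonempty)) := by
    ext ⟨i, j⟩
    rw [Finset.mem_filter]
    rcases j with _ | j
    · simp only [mem_addColOnes_zero, Finset.mem_erase]
      constructor
      · rintro ⟨h1, s, hs, hs'⟩
        exact ⟨((S.min'_le s hs').trans_lt hs).ne', h1⟩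
      · rintro ⟨h1, h2⟩
        exact ⟨h2, _, lt_of_le_of_ne (S.min'_le i h2) (Ne.symm h1), S.min'_mem _⟩
    · rcases i with _ | i
      · simp [zero_succ_notMem_addColOnes]
      · simp only [succ_mem_addColOnes, Finset.mem_filter]
        refine and_congr_right fun _ => ⟨?_, ?_⟩
        · rintro ⟨_ | i', h1, h2⟩
          · exact absurd h2 zero_succ_notMem_addColOnes
          · exact ⟨i', Nat.lt_of_succ_lt_succ h1, succ_mem_addColOnes.mp h2⟩
        · rintro ⟨i', h1, h2⟩
          exact ⟨i' + 1, Nat.succ_lt_succ h1, succ_mem_addColOnes.mpr h2⟩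
  have hcard (O : Finset (ℕ × ℕ)) (S : Finset ℕ) : (addColOnes O S).card = O.card + S.card := by
    rw [addColOnes, Finset.card_union_of_disjoint, Finset.card_product, Finset.card_map,
      Finset.card_singleton, mul_one, add_comm]
    rw [Finset.disjoint_left]
    rintro ⟨i, j⟩ h1 h2
    simp only [Finset.mem_product, Finset.mem_singleton] at h1
    obtain ⟨c, -, hc⟩ := Finset.mem_map.mp h2
    exact Nat.succ_ne_zero c.2 ((congrArg Prod.snd hc).trans h1.2)
  change Finset.card {c ∈ addColOnes T.ones S | ∃ i' < c.1, (i', c.2) ∈ addColOnes T.ones S} = _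
  rw [h, hcard, Finset.card_erase_of_mem (S.min'_mem _), so]

/-! ### The growth bijection -/

/-- The set of all ways to choose the ones of a column added to `T`. -/
noncomputable def columnChoices (T : TypeBTableau n) : Finset (Finset ℕ) :=
  {S ∈ (insert 0 (T.unrestricted.map ⟨Nat.succ, Nat.succ_injective⟩)).powerset | S.Nonempty}

theorem mem_columnChoices {T : TypeBTableau n} {S : Finset ℕ} :
    S ∈ T.columnChoices ↔ T.IsColumnChoice S := by
  rw [columnChoices, Finset.mem_filter, Finset.mem_powerset]
  constructor
  · rintro ⟨h1, h2⟩
    refine ⟨h2, fun i hi => ?_⟩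
    simpa using h1 hi
  · rintro ⟨h1, h2⟩
    refine ⟨fun i hi => ?_, h1⟩
    rcases i with _ | i
    · exact Finset.mem_insert_self _ _
    · exact Finset.mem_insert_of_mem (Finset.mem_map.mpr ⟨i, h2 i hi, rfl⟩)

/-- Lengthening a tableau by an empty row or a full column. -/
noncomputable def extend :
    TypeBTableau n ⊕ (Σ T : TypeBTableau n, T.columnChoices) → TypeBTableau (n + 1)
  | Sum.inl T => T.addRow
  | Sum.inr ⟨T, S⟩ => T.addCol S.1 (mem_columnChoices.mp S.2)

theorem addRow_ne_addCol (T T' : TypeBTableau n) (S : Finset ℕ) (hS : T'.IsColumnChoice S) :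
    T.addRow ≠ T'.addCol S hS := by
  intro h
  have h0 : 0 ∈ T.addRow.shape.rows := by simp [addRow, FerrersDiagram.addRow]
  rw [h] at h0
  simp [addCol, FerrersDiagram.addCol] at h0

theorem addRow_injective : Function.Injective (addRow (n := n)) := by
  intro T T' h
  have h1 : T.shape.addRow = T'.shape.addRow := congrArg shape h
  have h2 : T.addRow.ones = T'.addRow.ones := congrArg ones h
  refine ext ?_ h2
  rcases hF : T.shape with ⟨r, k, _, _⟩
  rcases hF' : T'.shape with ⟨r', k', _, _⟩
  rw [hF, hF'] at h1
  simp only [FerrersDiagram.addRow, FerrersDiagram.mk.injEq, List.append_cancel_right_eq] at h1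
  simpa using h1

theorem addCol_inj {T T' : TypeBTableau n} {S S' : Finset ℕ} {hS : T.IsColumnChoice S}
    {hS' : T'.IsColumnChoice S'} (h : T.addCol S hS = T'.addCol S' hS') : T = T' ∧ S = S' := by
  have h1 : T.shape.addCol = T'.shape.addCol := congrArg shape h
  have h2 : addColOnes T.ones S = addColOnes T'.ones S' := congrArg ones h
  refine ⟨ext ?_ ?_, ?_⟩
  · rcases hF : T.shape with ⟨r, k, _, _⟩
    rcases hF' : T'.shape with ⟨r', k', _, _⟩
    rw [hF, hF'] at h1
    simp only [FerrersDiagram.addCol, FerrersDiagram.mk.injEq, Nat.add_right_cancel_iff] at h1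
    simpa using ⟨(List.map_injective_iff.mpr Nat.succ_injective) h1.1, h1.2⟩
  · ext ⟨i, j⟩
    rw [← succ_mem_addColOnes (S := S), h2, succ_mem_addColOnes]
  · ext i
    rw [← mem_addColOnes_zero (O := T.ones), h2, mem_addColOnes_zero]

theorem exists_addRow_eq (T : TypeBTableau (n + 1)) (F : FerrersDiagram)
    (hF : T.shape = F.addRow) : ∃ T' : TypeBTableau n, T'.addRow = T := by
  obtain ⟨_, hl, O, h1, h2, h3, h4⟩ := T
  obtain rfl := hF
  rw [FerrersDiagram.shiftedCells_addRow] at h1 h3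
  rw [FerrersDiagram.length_addRow] at hl
  exact ⟨⟨F, Nat.succ_injective hl, O, h1, h2, h3, h4⟩, rfl⟩

/-- Deleting the first column and the top row leaves a tableau. The zero and diagonal conditions,
applied with a first-column one as the one to the left, say precisely that its row is unrestricted
or the top row. -/
theorem exists_addCol_eq (T : TypeBTableau (n + 1)) (F : FerrersDiagram)
    (hF : T.shape = F.addCol) : ∃ (T' : TypeBTableau n) (S : Finset ℕ) (hS : T'.IsColumnChoice S),
      T'.addCol S hS = T := by
  obtain ⟨_, hl, O, h1, h2, h3, h4⟩ := T
  obtain rfl := hF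
  have hl' : F.length = n := by rw [FerrersDiagram.length_addCol] at hl; exact Nat.succ_injective hl
  have hinj : Function.Injective (Prod.map Nat.succ Nat.succ) :=
    Nat.succ_injective.prodMap Nat.succ_injective
  have hmem (i j : ℕ) : (i, j) ∈ O.preimage _ hinj.injOn ↔ (i + 1, j + 1) ∈ O := by
    rw [Finset.mem_preimage]; rfl
  have h0 (j : ℕ) : (0, j + 1) ∉ O := fun h =>
    absurd ((FerrersDiagram.zero_mem_shiftedCells_addCol _ _).mp (h1 h)) (Nat.succ_ne_zero j)
  have hS (i : ℕ) : i ∈ ({c ∈ O | c.2 = 0}.image Prod.fst) ↔ (i, 0) ∈ O := by simp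
  have hO : addColOnes (O.preimage _ hinj.injOn) ({c ∈ O | c.2 = 0}.image Prod.fst) = O := by
    ext ⟨i, _ | j⟩
    · rw [mem_addColOnes_zero, hS]
    · rcases i with _ | i
      · exact iff_of_false zero_succ_notMem_addColOnes (h0 j)
      · rw [succ_mem_addColOnes, hmem]
  let T' : TypeBTableau n :=
    { shape := F
      length_eq := hl'
      ones := O.preimage _ hinj.injOn
      ones_subset := by
        rintro ⟨i, j⟩ h
        exact (FerrersDiagram.succ_mem_shiftedCells_addCol _ _ _).mp (h1 ((hmem i j).mp h))
      column_has_one := by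
        intro j hj
        -- The one of this column is not in the deleted top row, which only meets column `0`.
        obtain ⟨_ | i, hi⟩ := h2 (j + 1) (Nat.succ_lt_succ hj)
        · exact absurd hi (h0 j)
        · exact ⟨i, (hmem i j).mpr hi⟩
      zero_condition := by
        rintro i j hc hij ⟨⟨i', hi, hi'⟩, j', hj, hj'⟩
        rw [hmem] at hij hi' hj'
        exact h3 _ _ ((FerrersDiagram.succ_mem_shiftedCells_addCol _ _ _).mpr hc) hij
          ⟨⟨_, Nat.succ_lt_succ hi, hi'⟩, _, Nat.succ_lt_succ hj, hj'⟩
      diagonal_condition := by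
        rintro i hi hii ⟨j', hj, hj'⟩
        rw [hmem] at hii hj'
        exact h4 _ (Nat.succ_lt_succ hi) hii ⟨_, Nat.succ_lt_succ hj, hj'⟩ }
  have hS' : T'.IsColumnChoice ({c ∈ O | c.2 = 0}.image Prod.fst) := by
    constructor
    · obtain ⟨i, hi⟩ := h2 0 (Nat.succ_pos _)
      exact ⟨i, (hS i).mpr hi⟩
    · intro i hi
      rw [hS] at hi
      refine mem_unrestricted.mpr ⟨?_, fun j hc hij i' hi' h => ?_, fun hic => ?_⟩
      · have := (FerrersDiagram.mem_shiftedCells_addCol_zero _ _).mp (h1 hi)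
        omega
      · have hij' := mt (hmem i j).mpr hij
        exact h3 _ _ ((FerrersDiagram.succ_mem_shiftedCells_addCol _ _ _).mpr hc) hij'
          ⟨⟨_, Nat.succ_lt_succ hi', (hmem i' j).mp h⟩, 0, Nat.succ_pos j, hi⟩
      · refine (hmem i i).mpr ?_
        by_contra hii
        exact h4 _ (Nat.succ_lt_succ hic) hii ⟨0, Nat.succ_pos i, hi⟩
  exact ⟨T', _, hS', ext rfl hO⟩

theorem extend_bijective : Function.Bijective (extend (n := n)) := by
  constructor
  · rintro (T | ⟨T, S⟩) (T' | ⟨T', S'⟩) h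
    · exact congrArg _ (addRow_injective h)
    · exact absurd h (addRow_ne_addCol _ _ _ (mem_columnChoices.mp S'.2))
    · exact absurd h.symm (addRow_ne_addCol _ _ _ (mem_columnChoices.mp S.2))
    · obtain ⟨rfl, h'⟩ := addCol_inj (hS := mem_columnChoices.mp S.2) (hS' := mem_columnChoices.mp S'.2) h
      obtain rfl := Subtype.ext h'
      rfl
  · intro T
    rcases T.shape.exists_eq_addRow_or_addCol (by rw [T.length_eq]; exact Nat.succ_ne_zero n) with
      ⟨F, hF⟩ | ⟨F, hF⟩
    · obtain ⟨T', rfl⟩ := T.exists_addRow_eq F hF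
      exact ⟨Sum.inl T', rfl⟩
    · obtain ⟨T', S, hS, rfl⟩ := T.exists_addCol_eq F hF
      exact ⟨Sum.inr ⟨T', S, mem_columnChoices.mpr hS⟩, rfl⟩

/-! ### Weighted enumeration by the number of unrestricted rows -/

section Weights

variable {A : Type*} [CommRing A] (y t q : A)

/-- The contribution of a tableau to the generating polynomial. -/
noncomputable def weight (T : TypeBTableau n) : A :=
  y ^ (2 * T.row + T.diag) * t ^ T.diag * q ^ T.so

theorem weight_addRow (T : TypeBTableau n) :
    T.addRow.weight y t q = T.weight y t q * y ^ 2 := by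
  have h1 : T.addRow.diag = T.diag := rfl
  have h2 : T.addRow.so = T.so := rfl
  rw [weight, weight, h1, h2, row_addRow]
  ring

theorem weight_addCol (T : TypeBTableau n) (S : Finset ℕ) (hS : T.IsColumnChoice S) :
    (T.addCol S hS).weight y t q =
      T.weight y t q * ((if 0 ∈ S then y * t else 1) * q ^ (S.card - 1)) := by
  rw [weight, weight, row_addCol, diag_addCol, so_addCol]
  split_ifs <;> ring

/-- The choices split according to whether the new diagonal cell holds a one. If so, the other ones
form an arbitrary set, all superfluous; if not, the set is nonempty and its topmost one is not
superfluous. -/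
theorem sum_columnChoices (T : TypeBTableau n) (h : ℕ → A) :
    ∑ S : T.columnChoices, (T.addCol S (mem_columnChoices.mp S.2)).weight y t q *
        h (T.addCol S (mem_columnChoices.mp S.2)).unrestricted.card =
      T.weight y t q * (y * t * subsetSum q T.unrestricted.card (fun s => h (s + 1)) +
        nonemptySubsetSum q T.unrestricted.card h) := by
  set U := T.unrestricted.map ⟨Nat.succ, Nat.succ_injective⟩ with hU
  have hU0 : 0 ∉ U := by simp [hU]
  let g (S : Finset ℕ) : A := T.weight y t q * ((if 0 ∈ S then y * t else 1) * q ^ (S.card - 1) *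
    h (if 0 ∈ S then S.card else (survivors U S).card))
  have hg (S : T.columnChoices) : (T.addCol S (mem_columnChoices.mp S.2)).weight y t q *
      h (T.addCol S (mem_columnChoices.mp S.2)).unrestricted.card = g S := by
    rw [weight_addCol, mul_assoc]
    by_cases h0 : 0 ∈ S.1
    · simp only [g, if_pos h0, unrestricted_addCol_of_zero_mem _ _ _ h0]
    · simp only [g, if_neg h0, unrestricted_addCol_of_zero_notMem _ _ _ h0, hU]
  rw [Finset.sum_congr rfl fun S _ => hg S, Finset.sum_coe_sort T.columnChoices g, columnChoices,
    Finset.sum_filter, Finset.sum_powerset_insert hU0, ← Finset.card_map, ← hU,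
    ← sum_powerset_eq_nonemptySubsetSum, ← sum_powerset_eq_subsetSum, add_comm, mul_add,
    Finset.sum_filter]
  simp only [Finset.mul_sum]
  congr 1
  · refine Finset.sum_congr rfl fun S hS => ?_
    have h0 : 0 ∉ S := fun h => hU0 (Finset.mem_powerset.mp hS h)
    simp only [g, Finset.mem_insert_self, if_true, Finset.insert_nonempty,
      Finset.card_insert_of_notMem h0, Nat.add_sub_cancel]
    ring
  · refine Finset.sum_congr rfl fun S hS => ?_
    have h0 : 0 ∉ S := fun h => hU0 (Finset.mem_powerset.mp hS h)
    simp only [g, if_neg h0, one_mul, mul_ite, mul_zero]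

/-- The test function `h` is arbitrary so that the recursion can be iterated, although only `h = 1`
is needed in the end. -/
theorem sum_weight_succ (n : ℕ) (h : ℕ → A) :
    ∑ T : TypeBTableau (n + 1), T.weight y t q * h T.unrestricted.card =
      ∑ T : TypeBTableau n, T.weight y t q * transfer y t q h T.unrestricted.card := by
  rw [← extend_bijective.sum_comp, Fintype.sum_sum_type, Fintype.sum_sigma,
    ← Finset.sum_add_distrib]
  refine Finset.sum_congr rfl fun T _ => ?_
  simp only [extend]
  rw [sum_columnChoices, weight_addRow, card_unrestricted_addRow, transfer]
  ring

theorem eq_of_length_zero (T T' : TypeBTableau 0) : T = T' := by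
  have key (T : TypeBTableau 0) : T.shape.rows = [] ∧ T.shape.cols = 0 ∧ T.ones = ∅ := by
    have h := T.length_eq
    unfold FerrersDiagram.length at h
    refine ⟨List.length_eq_zero_iff.mp (by omega), by omega, ?_⟩
    exact Finset.eq_empty_of_forall_notMem fun c hc => Nat.not_lt_zero _ (lt_of_mem_ones hc)
  obtain ⟨h1, h2, h3⟩ := key T
  obtain ⟨h1', h2', h3'⟩ := key T'
  refine ext ?_ (h3.trans h3'.symm)
  rcases hF : T.shape with ⟨r, k, _, _⟩
  rcases hF' : T'.shape with ⟨r', k', _, _⟩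
  rw [hF] at h1 h2
  rw [hF'] at h1' h2'
  simp_all

/-- The tableau of length `0`. -/
def empty : TypeBTableau 0 where
  shape := ⟨[], 0, List.Pairwise.nil, by simp⟩
  length_eq := rfl
  ones := ∅
  ones_subset := Finset.empty_subset _
  column_has_one j hj := absurd hj (Nat.not_lt_zero j)
  zero_condition := by simp
  diagonal_condition := by simp

theorem sum_weight_zero (h : ℕ → A) :
    ∑ T : TypeBTableau 0, T.weight y t q * h T.unrestricted.card = h 0 := by
  rw [Fintype.sum_eq_single empty fun T hT => absurd (eq_of_length_zero T empty) hT]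
  have hU : empty.unrestricted = ∅ :=
    Finset.eq_empty_of_forall_notMem fun i hi => Nat.not_lt_zero i (mem_unrestricted.mp hi).1
  rw [hU]
  simp [weight, row, diag, so, empty]

theorem sum_weight_eq_transfer_iterate (n : ℕ) (h : ℕ → A) :
    ∑ T : TypeBTableau n, T.weight y t q * h T.unrestricted.card = (transfer y t q)^[n] h 0 := by
  induction n generalizing h with
  | zero => exact sum_weight_zero y t q h
  | succ n ih => rw [sum_weight_succ, ih, Function.iterate_succ_apply]

theorem typeBPolynomial_eq (n : ℕ) :
    typeBPolynomial n y t q = (transfer y t q)^[n] 1 0 := by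
  rw [← sum_weight_eq_transfer_iterate]
  simp [typeBPolynomial, weight]

end Weights

end TypeBTableau

/-! ### Conclusion -/

open Polynomial in
theorem typeBPolynomial_eq_iterate {R : Type*} [CommRing R] (y q : R) (n : ℕ) :
    typeBPolynomial n (C y) (X : R[X]) (C q) =
      (fun f => (C y + X) * qDerivMul y q f)^[n] 1 := by
  rw [TypeBTableau.typeBPolynomial_eq]
  simpa using pow_mul_transfer_iterate y q n 0

open Polynomial in
/-- Here `y` and `q` are arbitrary elements of a commutative ring `R`, for instance the two
indeterminates of `R = ℤ[y, q]`, and `t` is the indeterminate `X` of `R[X]`. -/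
theorem theorem5 {R : Type*} [CommRing R] (y q : R) :
    typeBPolynomial 0 (C y) (X : R[X]) (C q) = 1 ∧
    ∀ n : ℕ, typeBPolynomial (n + 1) (C y) (X : R[X]) (C q) =
      (C y + X) * qDeriv q ((1 + C y * X) * typeBPolynomial n (C y) (X : R[X]) (C q)) := by
  refine ⟨typeBPolynomial_eq_iterate y q 0, fun n => ?_⟩
  rw [typeBPolynomial_eq_iterate, typeBPolynomial_eq_iterate, Function.iterate_succ_apply',
    qDerivMul_apply]
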